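/- **Conventions.** Graphs are finite and simple. For a finite set $C$ of colours, $\binom{C}{\Delta}$ is the set of $\Delta$-element subsets of $C$; a map $c\colon E(G)\to\binom{C}{\Delta}$ is $k$-bounded if every $\alpha\in C$ lies in $c(e)$ for at most $k$ edges $e$. We write $a=b\pm x$ if $|a-b|\le x$. For numbers in $(0,1]$, "suppose $a\ll b\ll c_1,\dots,c_k$; then $P$ holds" means that there are increasing functions $f,g\colon(0,1]\to(0,1]$ such that $P$ holds whenever $a\le f(b)$ and $b\le g(c_i)$ for all $i$. In both parts $n,t,\Delta\ge 1$ are integers, $\mu,d\in(0,1]$, $\kappa:=4\sqrt{t^\Delta d^{-1}\mu}$, $G$ is a graph on $n$ vertices, $c\colon E(G)\to\binom{C}{\Delta}$ is $\mu n$-bounded, and $C$ is split randomly into $C_1,\dots,C_t$ by assigning each $\alpha\in C$ independently to $C_j$ with probability $1/t$ for every $j\in[t]$. **Lemma.** Suppose $1/n\ll\mu\ll 1/t,d,1/\Delta$ and $\delta(G)\ge dn$. For $\mathbf s=(s_1,\dots,s_t)\in\mathbb N_0^t$ with $\sum_j s_j=\Delta$ and $v\in V(G)$, let $d_{\mathbf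 s,v}$ be the number of edges $e$ incident to $v$ with $|c(e)\cap C_j|=s_j$ for all $j\in[t]$. Then with probability at least $\frac{\kappa}{3}(1+\kappa)^{-|C|}$ the following holds: $$d_{\mathbf s,v}=\frac{\Delta!}{s_1!\cdots s_t!}\,t^{-\Delta}d_G(v)\pm(2t)^\Delta\kappa n$$ simultaneously for all $v\in V(G)$ and all such $\mathbf s$. **Corollary.** Suppose $1/n\ll\mu\ll 1/t,d,1/\Delta,1/r$, where $r\ge1$ is an integer, and suppose that for every $v\in V(G)$ we are given a partition $S^v_1,\dots,S^v_{m_v}$ of the neighbourhood $N_G(v)$ into $m_v\le r$ sets of size at least $drn$ each. For $S\subseteq V(G)$ let $d_{C_\ell}(v,S)$ be the number of $u\in S$ with $uv\in E(G)$ and $c(uv)\subseteq C_\ell$. Then with probability at least $\frac{\kappa}{3}(1+\kappa)^{-|C|}$ the following holds: $$d_{C_\ell}(v,S^v_i)=t^{-\Delta}|S^v_i|\pm(2t)^\Delta\kappa rn$$ simultaneously for all $v\in V(G)$, $i\in[m_v]$ and $\ell\in[t]$. -/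

import Mathlib

open MeasureTheory

namespace ColourSplit

/-- An increasing function from `(0,1]` to `(0,1]`. A hierarchy `a ≪ b ≪ c₁, …, cₖ` of numbers in
`(0,1]` means that there are such functions `f`, `g` for which the assertion holds
whenever `a ≤ f b` and `b ≤ g cᵢ` for every `i`. -/
def IsThreshold (f : ℝ → ℝ) : Prop :=
  Set.MapsTo f (Set.Ioc 0 1) (Set.Ioc 0 1) ∧ StrictMonoOn f (Set.Ioc 0 1)

/-- An edge set colouring is `k`-bounded if each colour appears on at most `k` edges. -/
def IsBounded {V C : Type*} {G : SimpleGraph V} (c : G.edgeSet → Finset C) (k : ℝ) : Prop :=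
  ∀ α : C, (({e : G.edgeSet | α ∈ c e}.ncard : ℕ) : ℝ) ≤ k

/-- The class `C_j` of the splitting of the colours given by `ω`. -/
def colourClass {C : Type*} [Fintype C] {t : ℕ} (ω : C → Fin t) (j : Fin t) : Finset C :=
  Finset.univ.filter fun α => ω α = j

/-- The law of the random splitting: each colour is independently assigned to one of the `t` classes
with probability `1 / t` each. -/
noncomputable def splitMeasure (C : Type*) [Fintype C] (t : ℕ) : Measure (C → Fin t) :=
  Measure.pi fun _ => ProbabilityTheory.uniformOn (Set.univ : Set (Fin t))

/-- `d_{s,v}`: the number of edges `e` at `v` with `|c(e) ∩ C_j| = s_j` for all `j`. -/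
noncomputable def typeDegree {V C : Type*} [Fintype C] [DecidableEq C] {G : SimpleGraph V}
    (c : G.edgeSet → Finset C) {t : ℕ} (ω : C → Fin t) (s : Fin t → ℕ) (v : V) : ℕ :=
  {e : G.edgeSet | v ∈ (e : Sym2 V) ∧ ∀ j, (c e ∩ colourClass ω j).card = s j}.ncard

/-- `G_{C'}`: the spanning subgraph of `G` formed by the edges `e` with `c(e) ⊆ C'`. -/
def colourSubgraph {V C : Type*} {G : SimpleGraph V}
    (c : G.edgeSet → Finset C) (C' : Finset C) : SimpleGraph V :=
  SimpleGraph.fromEdgeSet {e | ∃ h : e ∈ G.edgeSet, c ⟨e, h⟩ ⊆ C'}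

/-- `d_H(v, S)`: the number of `H`-neighbours of `v` in `S`. -/
noncomputable def degreeInto {V : Type*} (H : SimpleGraph V) (v : V) (S : Finset V) : ℕ :=
  {u : V | u ∈ S ∧ H.Adj v u}.ncard

end ColourSplit

/-! Order the colours of each edge, so that a splitting gives every edge a profile in `Fin Δ → Fin
t`; a fixed profile has probability `t ^ (-Δ)`. It suffices to bound the number of edges of each
profile from above: the profiles partition the edges, so the upper bounds on the complement of a set
of profiles give the lower bound on the set (`abs_card_profile_mem_sub_le`). A colour type is a set
of profiles of multinomial size, and `c(e) ⊆ C_ℓ` is a single profile.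

That all upper bounds hold at once is shown by an induction in the spirit of the local lemma, over
sets `S` of colours. Each constraint is replaced by a piecewise linear cut-off of its load, counting
only patterns whose colours all lie in `S`, and `softCount` sums the product of the cut-offs over
all maps. For `S = ∅` it is `t ^ |C|`; for `S = C` it is at most the number of good maps. So it is
enough that adding a colour costs a factor of at most `1 + κ` (`slowDecay`).

A new colour `a` changes the load of a constraint only by realised patterns containing `a`, and a
cut-off is Lipschitz with constant `1 / gap`. By induction, a pattern has probability at most `((1 +
κ) / t) ^ Δ` under the measure with density `softGood` (`sum_indicator_le`), and omitting one
constraint at most doubles the count, since its load is rarely near the threshold (`tail_le`).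
Summed over all profiles, the loss is of order `μ n / gap`; with `gap` of order `κ r n` this is at
most of order `κ`, because `κ ^ 2 ≥ 16 μ`. -/

namespace ColourSplit

/-! ### Differences of products and a soft threshold -/

/-- Telescoping bound for the difference of two products. -/
theorem prod_sub_prod_le_sum {ι : Type*} [DecidableEq ι] (s : Finset ι) (a b : ι → ℝ)
    (hb : ∀ i, 0 ≤ b i) (hab : ∀ i, b i ≤ a i) :
    ∏ i ∈ s, a i - ∏ i ∈ s, b i ≤ ∑ i ∈ s, (a i - b i) * ∏ j ∈ s.erase i, a j := by
  induction s using Finset.induction_on with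
  | empty => simp
  | insert i s his ih =>
    rw [Finset.prod_insert his, Finset.prod_insert his, Finset.sum_insert his,
      Finset.erase_insert his]
    have h1 : ∑ k ∈ s, (a k - b k) * ∏ j ∈ (insert i s).erase k, a j
        = a i * ∑ k ∈ s, (a k - b k) * ∏ j ∈ s.erase k, a j := by
      rw [Finset.mul_sum]
      refine Finset.sum_congr rfl fun k hk => ?_
      have hki : i ≠ k := fun h => his (h ▸ hk)
      rw [Finset.erase_insert_of_ne hki, Finset.prod_insert (fun h => his (Finset.mem_of_mem_erase h))]
      ring
    rw [h1]
    have hPb : ∏ j ∈ s, b j ≤ ∏ j ∈ s, a j :=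
      Finset.prod_le_prod (fun j _ => hb j) fun j _ => hab j
    have h0 : 0 ≤ a i := (hb i).trans (hab i)
    have h2 := mul_le_mul_of_nonneg_left ih h0
    have h3 := mul_le_mul_of_nonneg_left hPb (sub_nonneg.2 (hab i))
    nlinarith

/-- A continuous cut-off: `1` up to `T - η`, `0` from `T` on, linear in between. -/
noncomputable def cutoff (T η x : ℝ) : ℝ := max 0 (min 1 ((T - x) / η))

theorem cutoff_nonneg (T η x : ℝ) : 0 ≤ cutoff T η x := le_max_left _ _

theorem cutoff_le_one (T η x : ℝ) : cutoff T η x ≤ 1 :=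
  max_le zero_le_one (min_le_left _ _)

theorem cutoff_eq_one {T η x : ℝ} (hη : 0 < η) (h : x ≤ T - η) : cutoff T η x = 1 := by
  have : 1 ≤ (T - x) / η := by rw [le_div_iff₀ hη]; linarith
  simp [cutoff, min_eq_left this]

theorem cutoff_eq_zero {T η x : ℝ} (hη : 0 < η) (h : T ≤ x) : cutoff T η x = 0 := by
  have : (T - x) / η ≤ 0 := div_nonpos_of_nonpos_of_nonneg (by linarith) hη.le
  exact max_eq_left ((min_le_right _ _).trans this)

theorem cutoff_anti {T η x y : ℝ} (hη : 0 < η) (h : x ≤ y) : cutoff T η y ≤ cutoff T η x := by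
  unfold cutoff
  gcongr

theorem cutoff_sub_le {T η x y : ℝ} (hη : 0 < η) (h : x ≤ y) :
    cutoff T η x - cutoff T η y ≤ (y - x) / η := by
  have h1 : (T - x) / η = (T - y) / η + (y - x) / η := by ring
  have h2 : 0 ≤ (y - x) / η := div_nonneg (by linarith) hη.le
  unfold cutoff
  rw [h1]
  generalize (T - y) / η = u at *
  generalize (y - x) / η = z at *
  rcases max_cases 0 (min 1 (u + z)) with h | h <;> rcases max_cases 0 (min 1 u) with h' | h' <;>
  rcases min_cases 1 (u + z) with k | k <;> rcases min_cases 1 u with k' | k' <;> linarith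

/-! ### Uniform maps with prescribed values -/

section Patterns

variable {C : Type*} [Fintype C] [DecidableEq C] {t : ℕ}

/-- Resampling the coordinate `a` preserves the uniform distribution: changing the value at `a` from
`j` to `j'` is a bijection between the corresponding fibres. -/
theorem sum_eq_sum_update (a : C) (f : (C → Fin t) → ℝ) :
    (t : ℝ) * ∑ ω, f ω = ∑ ω, ∑ j, f (Function.update ω a j) := by
  have h : ∀ j j' : Fin t, ∑ ω : C → Fin t, (if ω a = j then f (Function.update ω a j') else 0)
      = ∑ ω : C → Fin t, if ω a = j' then f ω else 0 := by
    intro j j'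
    rw [← Finset.sum_filter, ← Finset.sum_filter]
    refine Finset.sum_nbij' (fun ω => Function.update ω a j') (fun ω => Function.update ω a j)
      ?_ ?_ ?_ ?_ ?_
    · intro ω hω; simp
    · intro ω hω; simp
    · intro ω hω
      simp only [Finset.mem_filter, Finset.mem_univ, true_and] at hω
      simp [← hω]
    · intro ω hω
      simp only [Finset.mem_filter, Finset.mem_univ, true_and] at hω
      simp [← hω]
    · intro ω hω; rfl
  have h1 : ∀ ω : C → Fin t, ∀ g : ℝ, g = ∑ j : Fin t, if ω a = j then g else 0 := by
    intro ω g; simp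
  calc (t : ℝ) * ∑ ω, f ω = ∑ j : Fin t, ∑ j', ∑ ω : C → Fin t, if ω a = j' then f ω else 0 := by
        rw [Finset.sum_const, Finset.sum_comm]
        simp
    _ = ∑ j : Fin t, ∑ j', ∑ ω : C → Fin t,
          (if ω a = j then f (Function.update ω a j') else 0) := by
        refine Finset.sum_congr rfl fun j _ => Finset.sum_congr rfl fun j' _ => (h j j').symm
    _ = _ := by
        rw [Finset.sum_comm]
        simp_rw [Finset.sum_comm (s := (Finset.univ : Finset (Fin t))) (t := (Finset.univ : Finset (C → Fin t)))]
        simp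

/-- Prescribing the values on `D` costs exactly a factor `t ^ |D|` for functions that do not
depend on the coordinates in `D`. -/
theorem pow_mul_sum_indicator (D : Finset C) (σ : C → Fin t) (f : (C → Fin t) → ℝ)
    (hf : ∀ ω ω' : C → Fin t, (∀ α, α ∉ D → ω α = ω' α) → f ω = f ω') :
    (t : ℝ) ^ D.card * ∑ ω, (if ∀ α ∈ D, ω α = σ α then f ω else 0) = ∑ ω, f ω := by
  induction D using Finset.induction_on generalizing f with
  | empty => simp
  | insert a D ha ih =>
    rw [Finset.card_insert_of_notMem ha, pow_succ, mul_assoc, sum_eq_sum_update a]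
    rw [← ih f fun ω ω' h => hf ω ω' fun α hα => h α fun h' => hα (Finset.mem_insert_of_mem h')]
    congr 1
    refine Finset.sum_congr rfl fun ω _ => ?_
    have : ∀ j, (if ∀ α ∈ insert a D, Function.update ω a j α = σ α then
        f (Function.update ω a j) else 0)
        = if j = σ a then (if ∀ α ∈ D, ω α = σ α then f ω else 0) else 0 := by
      intro j
      have h1 : f (Function.update ω a j) = f ω := hf _ _ fun α hα => by
        rw [Function.update_of_ne]
        rintro rfl
        exact hα (Finset.mem_insert_self _ _)
      have h2 : (∀ α ∈ D, Function.update ω a j α = σ α) ↔ ∀ α ∈ D, ω α = σ α := by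
        refine forall₂_congr fun α hα => ?_
        rw [Function.update_of_ne]
        rintro rfl
        exact ha hα
      rw [h1, ← ite_and]
      simp only [Finset.forall_mem_insert, Function.update_self, h2]
    simp_rw [this]
    simp

end Patterns

/-! ### Pattern systems and the induction over colours -/

/-- A system of upper bound constraints for random maps `ω : C → Fin t`. A pattern `e` prescribes
the values `val e` on the set `dom e`; the constraint `q` asks that fewer than `thr q` of the
patterns in `fam q` are realised by `ω`. The number `gap` is the width of the soft thresholds. -/
structure PatternSystem (C E Q : Type*) (t : ℕ) where
  dom : E → Finset C
  val : E → C → Fin t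
  fam : Q → Finset E
  thr : Q → ℝ
  gap : ℝ

namespace PatternSystem

variable {C E Q : Type*} [Fintype C] [DecidableEq C] {t : ℕ}
  (P : PatternSystem C E Q t)

/-- The number of patterns of `fam q` that lie inside `S` and are realised by `ω`. -/
def load (q : Q) (S : Finset C) (ω : C → Fin t) : ℕ :=
  ((P.fam q).filter fun e => P.dom e ⊆ S ∧ ∀ α ∈ P.dom e, ω α = P.val e α).card

/-- The product of the soft indicators of the constraints in `I`, restricted to the colours in
`S`. -/
noncomputable def softGood (I : Finset Q) (S : Finset C) (ω : C → Fin t) : ℝ :=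
  ∏ q ∈ I, cutoff (P.thr q) P.gap (P.load q S ω)

/-- The (unnormalised) expectation of `softGood`. -/
noncomputable def softCount (I : Finset Q) (S : Finset C) : ℝ :=
  ∑ ω, P.softGood I S ω

theorem load_mono {q : Q} {S S' : Finset C} (h : S ⊆ S') (ω : C → Fin t) :
    P.load q S ω ≤ P.load q S' ω :=
  Finset.card_le_card (Finset.monotone_filter_right _ fun _ _ he => ⟨he.1.trans h, he.2⟩)

theorem load_congr {q : Q} {S : Finset C} {ω ω' : C → Fin t} (h : ∀ α ∈ S, ω α = ω' α) :
    P.load q S ω = P.load q S ω' := by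
  unfold load
  congr 1
  refine Finset.filter_congr fun e _ => and_congr_right fun he => forall₂_congr fun α hα => ?_
  rw [h α (he hα)]

/-- A realised pattern that stops being counted when the colours of `e` are deleted must share a
colour with `e`. -/
theorem load_le_load_sdiff (q : Q) (e : E) (S : Finset C) (ω : C → Fin t) :
    P.load q S ω ≤ P.load q (S \ P.dom e) ω +
      ((P.fam q).filter fun f => ¬ Disjoint (P.dom f) (P.dom e)).card := by
  classical
  unfold load
  rw [← Finset.card_union_add_card_inter]
  refine le_trans (Finset.card_le_card ?_) (Nat.le_add_right _ _)
  intro f hf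
  simp only [Finset.mem_filter, Finset.mem_union] at hf ⊢
  by_cases hd : Disjoint (P.dom f) (P.dom e)
  · exact Or.inl ⟨hf.1, Finset.subset_sdiff.2 ⟨hf.2.1, hd⟩, hf.2.2⟩
  · exact Or.inr ⟨hf.1, hd⟩

theorem load_insert_le (q : Q) (a : C) (S : Finset C) (ω : C → Fin t) :
    (P.load q (insert a S) ω : ℝ) ≤ P.load q S ω +
      ∑ e ∈ (P.fam q).filter fun e => a ∈ P.dom e,
        if ∀ α ∈ P.dom e, ω α = P.val e α then (1 : ℝ) else 0 := by
  classical
  have h : P.load q (insert a S) ω ≤ P.load q S ω +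
      (((P.fam q).filter fun e => a ∈ P.dom e).filter fun e =>
        ∀ α ∈ P.dom e, ω α = P.val e α).card := by
    unfold load
    rw [← Finset.card_union_add_card_inter]
    refine le_trans (Finset.card_le_card ?_) (Nat.le_add_right _ _)
    intro f hf
    simp only [Finset.mem_filter, Finset.mem_union] at hf ⊢
    by_cases ha : a ∈ P.dom f
    · exact Or.inr ⟨⟨hf.1, ha⟩, hf.2.2⟩
    · exact Or.inl ⟨hf.1, (Finset.subset_insert_iff_of_notMem ha).1 hf.2.1, hf.2.2⟩
  rw [Finset.sum_boole]
  exact_mod_cast h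

theorem load_le_sum (q : Q) (S : Finset C) (ω : C → Fin t) :
    (P.load q S ω : ℝ) ≤
      ∑ e ∈ P.fam q, if ∀ α ∈ P.dom e, ω α = P.val e α then (1 : ℝ) else 0 := by
  rw [Finset.sum_boole]
  exact_mod_cast Finset.card_le_card (Finset.monotone_filter_right _ fun _ _ (he : _ ∧ _) => he.2)

theorem softGood_nonneg (I : Finset Q) (S : Finset C) (ω : C → Fin t) : 0 ≤ P.softGood I S ω :=
  Finset.prod_nonneg fun _ _ => cutoff_nonneg _ _ _

theorem softCount_nonneg (I : Finset Q) (S : Finset C) : 0 ≤ P.softCount I S :=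
  Finset.sum_nonneg fun _ _ => P.softGood_nonneg I S _

theorem softGood_anti (hgap : 0 < P.gap) (I : Finset Q) {S S' : Finset C} (h : S ⊆ S')
    (ω : C → Fin t) : P.softGood I S' ω ≤ P.softGood I S ω :=
  Finset.prod_le_prod (fun _ _ => cutoff_nonneg _ _ _) fun _ _ =>
    cutoff_anti hgap (by exact_mod_cast P.load_mono h ω)

theorem softGood_congr (I : Finset Q) {S : Finset C} {ω ω' : C → Fin t}
    (h : ∀ α ∈ S, ω α = ω' α) : P.softGood I S ω = P.softGood I S ω' :=
  Finset.prod_congr rfl fun q _ => by rw [P.load_congr h]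

/-- Adding a colour to a set with fewer than `N` elements decreases each soft count by a factor of
at most `1 + κ`. -/
def SlowDecay (κ : ℝ) (N : ℕ) : Prop :=
  ∀ (I : Finset Q) (S : Finset C) (a : C), S.card < N → a ∉ S →
    P.softCount I S ≤ (1 + κ) * P.softCount I (insert a S)

variable {P} {κ : ℝ} {N Δ : ℕ}

/-- Put the colours of `D` back one at a time: each costs at most `1 + κ`, and those outside `R`
change nothing. -/
theorem SlowDecay.softCount_sdiff_le (h : P.SlowDecay κ N) (hκ : 0 ≤ κ) (I : Finset Q)
    {R : Finset C} (hR : R.card ≤ N) (D : Finset C) :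
    P.softCount I (R \ D) ≤ (1 + κ) ^ D.card * P.softCount I R := by
  induction D using Finset.induction_on with
  | empty => simp
  | insert a D ha ih =>
    rw [Finset.card_insert_of_notMem ha, pow_succ', mul_assoc, Finset.sdiff_insert]
    have h1 : P.softCount I ((R \ D).erase a) ≤ (1 + κ) * P.softCount I (R \ D) := by
      by_cases haR : a ∈ R \ D
      · have := h I ((R \ D).erase a) a
          (((Finset.card_erase_lt_of_mem haR).trans_le
            (Finset.card_le_card Finset.sdiff_subset)).trans_le hR) (Finset.notMem_erase _ _)
        rwa [Finset.insert_erase haR] at this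
      · rw [Finset.erase_eq_of_notMem haR]
        nlinarith [P.softCount_nonneg I (R \ D)]
    exact h1.trans (mul_le_mul_of_nonneg_left ih (by linarith))

/-- Deleting the colours of `e` from `R` makes the density independent of whether `e` is realised,
so that event contributes exactly `t ^ (-Δ)`. Restoring the colours costs at most `(1 + κ) ^ Δ`. -/
theorem SlowDecay.sum_indicator_le (h : P.SlowDecay κ N) (hκ : 0 ≤ κ) (ht : 1 ≤ t)
    (hgap : 0 < P.gap) (hdom : ∀ e, (P.dom e).card = Δ) (I : Finset Q) {R : Finset C}
    (hR : R.card ≤ N) (e : E) :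
    ∑ ω, (if ∀ α ∈ P.dom e, ω α = P.val e α then P.softGood I R ω else 0) ≤
      ((1 + κ) / t) ^ Δ * P.softCount I R := by
  have ht' : (0 : ℝ) < t := by exact_mod_cast ht
  have h1 := pow_mul_sum_indicator (P.dom e) (P.val e) (P.softGood I (R \ P.dom e))
    fun ω ω' hω => P.softGood_congr I fun α hα => hω α (Finset.mem_sdiff.1 hα).2
  have h2 := h.softCount_sdiff_le hκ I hR (P.dom e)
  rw [hdom] at h1 h2
  rw [div_pow, div_mul_eq_mul_div, le_div_iff₀ (by positivity), mul_comm]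
  refine le_trans ?_ (h1.le.trans h2)
  gcongr with ω
  split_ifs
  · exact P.softGood_anti hgap I Finset.sdiff_subset ω
  · exact le_rfl

/-- Upper tail of the load of a constraint under the measure with density `softGood I R`: each
realised pattern can be removed at the cost of `B` in the load. -/
theorem SlowDecay.tail_le (h : P.SlowDecay κ N) (hκ : 0 ≤ κ) (ht : 1 ≤ t)
    (hgap : 0 < P.gap) (hdom : ∀ e, (P.dom e).card = Δ) (q : Q) {B : ℝ} (hB : 0 ≤ B)
    (hmeet : ∀ e, (((P.fam q).filter fun f => ¬ Disjoint (P.dom f) (P.dom e)).card : ℝ) ≤ B)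
    {y : ℝ} (hy : 0 < y) (k : ℕ) (I : Finset Q) {R : Finset C} (hR : R.card ≤ N) :
    ∑ ω, (if y + k * B ≤ P.load q R ω then P.softGood I R ω else 0) ≤
      ((P.fam q).card * ((1 + κ) / t) ^ Δ / y) ^ k * P.softCount I R := by
  have ht' : (0 : ℝ) < t := by exact_mod_cast ht
  induction k generalizing R with
  | zero =>
    rw [pow_zero, one_mul]
    refine Finset.sum_le_sum fun ω _ => ?_
    split_ifs
    · exact le_rfl
    · exact P.softGood_nonneg I R ω
  | succ k ih =>
    set M : ℝ := (P.fam q).card * ((1 + κ) / t) ^ Δ with hM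
    have hM0 : 0 ≤ M := by positivity
    -- A Markov step: on the event at least `y` patterns are realised. For each of them, deleting
    -- its colours lowers the load by at most `B`, which leaves the event for `k`.
    have hpoint : ∀ ω : C → Fin t, y * (if y + (k + 1 : ℕ) * B ≤ P.load q R ω then
        P.softGood I R ω else 0) ≤ ∑ e ∈ P.fam q, if ∀ α ∈ P.dom e, ω α = P.val e α then
          (if y + k * B ≤ P.load q (R \ P.dom e) ω then P.softGood I (R \ P.dom e) ω else 0)
          else 0 := by
      intro ω
      have hg := P.softGood_nonneg I R ω
      split_ifs with hω
      · have h1 : y ≤ P.load q R ω := by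
          have : 0 ≤ ((k + 1 : ℕ) : ℝ) * B := by positivity
          linarith
        refine (mul_le_mul_of_nonneg_right (h1.trans (P.load_le_sum q R ω)) hg).trans ?_
        rw [Finset.sum_mul]
        refine Finset.sum_le_sum fun e _ => ?_
        split_ifs with he hl
        · rw [one_mul]
          exact P.softGood_anti hgap I Finset.sdiff_subset ω
        · exfalso
          apply hl
          have h2 : (P.load q R ω : ℝ) ≤ P.load q (R \ P.dom e) ω +
            ((P.fam q).filter fun f => ¬ Disjoint (P.dom f) (P.dom e)).card := by
            exact_mod_cast P.load_le_load_sdiff q e R ω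
          have h3 := hmeet e
          push_cast at hω
          linarith
        · simp
      · rw [mul_zero]
        refine Finset.sum_nonneg fun e _ => ?_
        split_ifs
        · exact P.softGood_nonneg _ _ _
        · exact le_rfl
        · exact le_rfl
    -- The inner summand does not depend on the colours of `e`, so fixing them gives exactly `t ^
    -- (-Δ)`; then the induction on `k` applies to the smaller set.
    have hterm : ∀ e, ∑ ω : C → Fin t, (if ∀ α ∈ P.dom e, ω α = P.val e α then
        (if y + k * B ≤ P.load q (R \ P.dom e) ω then P.softGood I (R \ P.dom e) ω else 0)
          else 0) ≤ ((1 + κ) / t) ^ Δ * ((M / y) ^ k * P.softCount I R) := by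
      intro e
      have h1 := pow_mul_sum_indicator (P.dom e) (P.val e)
        (fun ω => if y + k * B ≤ P.load q (R \ P.dom e) ω then P.softGood I (R \ P.dom e) ω else 0)
        (fun ω ω' hω => by
          have : ∀ α ∈ R \ P.dom e, ω α = ω' α := fun α hα => hω α (Finset.mem_sdiff.1 hα).2
          simp only [P.load_congr this, P.softGood_congr I this])
      have h2 := ih (R := R \ P.dom e) ((Finset.card_le_card Finset.sdiff_subset).trans hR)
      have h3 := h.softCount_sdiff_le hκ I hR (P.dom e)
      rw [hdom] at h1 h3
      rw [div_pow, div_mul_eq_mul_div, le_div_iff₀ (by positivity), mul_comm, h1]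
      refine h2.trans ?_
      calc _ ≤ (M / y) ^ k * ((1 + κ) ^ Δ * P.softCount I R) :=
            mul_le_mul_of_nonneg_left h3 (by positivity)
        _ = _ := by ring
    have hsum : y * ∑ ω, (if y + (k + 1 : ℕ) * B ≤ P.load q R ω then P.softGood I R ω else 0)
        ≤ M * ((M / y) ^ k * P.softCount I R) := by
      rw [Finset.mul_sum]
      refine (Finset.sum_le_sum fun ω _ => hpoint ω).trans ?_
      rw [Finset.sum_comm]
      refine (Finset.sum_le_sum fun e _ => hterm e).trans ?_
      rw [Finset.sum_const, nsmul_eq_mul, hM]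
      exact le_of_eq (by ring)
    rw [pow_succ, mul_right_comm, mul_div_assoc', le_div_iff₀ hy, mul_comm]
    refine hsum.trans (le_of_eq (by ring))

variable (P)

/-- Induction on the size of `S`: slow decay below `N` supplies both the tail bound and the pattern
probabilities needed to add one colour to a set of size at most `N`. Here `htail` makes each single
constraint likely to be slack, and `hinc` bounds the total expected effect of one colour. -/
theorem slowDecay [DecidableEq Q] (hκ : 0 ≤ κ) (ht : 1 ≤ t) (hgap : 0 < P.gap)
    (hdom : ∀ e, (P.dom e).card = Δ) {B : ℝ} (hB : 0 ≤ B)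
    (hmeet : ∀ q e, (((P.fam q).filter fun f => ¬ Disjoint (P.dom f) (P.dom e)).card : ℝ) ≤ B)
    (htail : ∀ q, ∃ y : ℝ, ∃ k : ℕ, 0 < y ∧ y + k * B ≤ P.thr q - P.gap ∧
      ((P.fam q).card * ((1 + κ) / t) ^ Δ / y) ^ k ≤ 1 / 2)
    (hinc : ∀ (I : Finset Q) (a : C),
      2 * (1 + κ) * ((1 + κ) / t) ^ Δ *
        ∑ q ∈ I, (((P.fam q).filter fun e => a ∈ P.dom e).card : ℝ) ≤ κ * P.gap)
    (N : ℕ) : P.SlowDecay κ N := by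
  induction N with
  | zero => intro I S a hS; simp at hS
  | succ N ih =>
    intro I S a hS _
    have hS' : S.card ≤ N := Nat.lt_succ_iff.1 hS
    -- Where the load stays below `thr q - gap`, the cut-off of `q` equals `1` and may be dropped.
    -- The rest has at most half of the mass of the system without `q`.
    have hdrop : ∀ q ∈ I, P.softCount (I.erase q) S ≤ 2 * P.softCount I S := by
      intro q hq
      obtain ⟨y, k, hy, hyk, hhalf⟩ := htail q
      have h1 := ih.tail_le hκ ht hgap hdom q hB (hmeet q) hy k (I.erase q) hS'
      have h2 := mul_le_mul_of_nonneg_right hhalf (P.softCount_nonneg (I.erase q) S)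
      have h3 : P.softCount (I.erase q) S ≤ P.softCount I S + ∑ ω,
          (if y + k * B ≤ P.load q S ω then P.softGood (I.erase q) S ω else 0) := by
        unfold softCount
        rw [← Finset.sum_add_distrib]
        refine Finset.sum_le_sum fun ω _ => ?_
        split_ifs with hω
        · linarith [P.softGood_nonneg I S ω]
        · have : P.softGood I S ω = P.softGood (I.erase q) S ω := by
            unfold softGood
            rw [← Finset.mul_prod_erase I _ hq, cutoff_eq_one hgap (by linarith), one_mul]
          linarith
      linarith
    -- Telescope the product. Each cut-off falls by at most the load increment over `gap`, and the
    -- remaining factors are the soft indicators without `q` at `S`, to which the induction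
    -- hypothesis applies.
    have hdiff : P.softCount I S - P.softCount I (insert a S) ≤
        ∑ q ∈ I, ∑ e ∈ (P.fam q).filter fun e => a ∈ P.dom e,
          (2 * ((1 + κ) / t) ^ Δ / P.gap) * P.softCount I S := by
      have h1 : P.softCount I S - P.softCount I (insert a S) ≤
          ∑ ω, ∑ q ∈ I, ∑ e ∈ (P.fam q).filter fun e => a ∈ P.dom e,
            P.gap⁻¹ * (if ∀ α ∈ P.dom e, ω α = P.val e α then
              P.softGood (I.erase q) S ω else 0) := by
        unfold softCount
        rw [← Finset.sum_sub_distrib]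
        refine Finset.sum_le_sum fun ω _ => ?_
        refine (prod_sub_prod_le_sum I _ _ (fun _ => cutoff_nonneg _ _ _)
          (fun q => cutoff_anti hgap (by exact_mod_cast P.load_mono (Finset.subset_insert a S) ω))).trans ?_
        refine Finset.sum_le_sum fun q _ => ?_
        have hl : (P.load q S ω : ℝ) ≤ P.load q (insert a S) ω := by
          exact_mod_cast P.load_mono (Finset.subset_insert a S) ω
        have h2 := (cutoff_sub_le (T := P.thr q) hgap hl).trans
          (div_le_div_of_nonneg_right (sub_le_iff_le_add'.2 (P.load_insert_le q a S ω)) hgap.le)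
        refine (mul_le_mul_of_nonneg_right h2 (P.softGood_nonneg (I.erase q) S ω)).trans
          (le_of_eq ?_)
        rw [div_eq_inv_mul, mul_assoc, Finset.sum_mul, Finset.mul_sum]
        refine Finset.sum_congr rfl fun e _ => ?_
        split_ifs <;> simp
      refine h1.trans ?_
      rw [Finset.sum_comm]
      refine Finset.sum_le_sum fun q hq => ?_
      rw [Finset.sum_comm]
      refine Finset.sum_le_sum fun e _ => ?_
      rw [← Finset.mul_sum]
      have h2 := ih.sum_indicator_le hκ ht hgap hdom (I.erase q) hS' e
      have h3 : 0 ≤ ((1 + κ) / t) ^ Δ := by positivity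
      calc _ ≤ P.gap⁻¹ * (((1 + κ) / t) ^ Δ * (2 * P.softCount I S)) := by
            refine mul_le_mul_of_nonneg_left (h2.trans ?_) (by positivity)
            exact mul_le_mul_of_nonneg_left (hdrop q hq) h3
        _ = _ := by ring
    have hsum : ∑ q ∈ I, ∑ e ∈ (P.fam q).filter fun e => a ∈ P.dom e,
          (2 * ((1 + κ) / t) ^ Δ / P.gap) * P.softCount I S =
        (2 * ((1 + κ) / t) ^ Δ * (∑ q ∈ I, (((P.fam q).filter fun e => a ∈ P.dom e).card : ℝ)))
          / P.gap * P.softCount I S := by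
      simp_rw [Finset.sum_const, nsmul_eq_mul]
      rw [← Finset.sum_mul]
      ring
    rw [hsum] at hdiff
    -- With `x` the relative loss, `x * (1 + κ) ≤ κ` says that `(1 - x) * (1 + κ) ≥ 1`, which is the
    -- required decay.
    have hx : (2 * ((1 + κ) / t) ^ Δ *
        (∑ q ∈ I, (((P.fam q).filter fun e => a ∈ P.dom e).card : ℝ))) / P.gap * (1 + κ) ≤ κ := by
      rw [div_mul_eq_mul_div, div_le_iff₀ hgap]
      refine le_trans (le_of_eq ?_) (hinc I a)
      ring
    set x := (2 * ((1 + κ) / t) ^ Δ *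
        (∑ q ∈ I, (((P.fam q).filter fun e => a ∈ P.dom e).card : ℝ))) / P.gap
    have hz := P.softCount_nonneg I S
    have h5 := mul_le_mul_of_nonneg_left hdiff (show 0 ≤ 1 + κ by linarith)
    have h6 := mul_le_mul_of_nonneg_right hx hz
    nlinarith

theorem pow_card_le_mul_card_good [Fintype Q] (hκ : 0 ≤ κ) (ht : 1 ≤ t) (hgap : 0 < P.gap)
    (hΔ : 1 ≤ Δ) (hdom : ∀ e, (P.dom e).card = Δ) {B : ℝ} (hB : 0 ≤ B)
    (hmeet : ∀ q e, (((P.fam q).filter fun f => ¬ Disjoint (P.dom f) (P.dom e)).card : ℝ) ≤ B)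
    (htail : ∀ q, ∃ y : ℝ, ∃ k : ℕ, 0 < y ∧ y + k * B ≤ P.thr q - P.gap ∧
      ((P.fam q).card * ((1 + κ) / t) ^ Δ / y) ^ k ≤ 1 / 2)
    (hinc : ∀ a : C, 2 * (1 + κ) * ((1 + κ) / t) ^ Δ *
      ∑ q, (((P.fam q).filter fun e => a ∈ P.dom e).card : ℝ) ≤ κ * P.gap) :
    (t : ℝ) ^ Fintype.card C ≤ (1 + κ) ^ Fintype.card C *
      (Finset.univ.filter fun ω : C → Fin t =>
        ∀ q, (P.load q Finset.univ ω : ℝ) ≤ P.thr q).card := by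
  classical
  have hslow : P.SlowDecay κ (Fintype.card C) := by
    refine P.slowDecay hκ ht hgap hdom hB hmeet htail (fun I a => ?_) _
    refine le_trans (mul_le_mul_of_nonneg_left ?_ (by positivity)) (hinc a)
    exact Finset.sum_le_sum_of_subset_of_nonneg (Finset.subset_univ I) fun _ _ _ => by positivity
  have h1 := hslow.softCount_sdiff_le hκ Finset.univ (R := Finset.univ) le_rfl Finset.univ
  rw [Finset.sdiff_self, Finset.card_univ] at h1
  -- As `Δ ≥ 1`, no pattern fits into `∅`, so all loads vanish; `htail` forces `thr q - gap > 0`, so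
  -- all cut-offs are `1`.
  have h2 : P.softCount Finset.univ ∅ = (t : ℝ) ^ Fintype.card C := by
    have : ∀ ω : C → Fin t, P.softGood Finset.univ ∅ ω = 1 := by
      intro ω
      refine Finset.prod_eq_one fun q _ => cutoff_eq_one hgap ?_
      have h0 : P.load q ∅ ω = 0 := by
        refine Finset.card_eq_zero.2 (Finset.filter_eq_empty_iff.2 fun e _ he => ?_)
        have := hdom e
        rw [Finset.subset_empty.1 he.1, Finset.card_empty] at this
        omega
      obtain ⟨y, k, hy, hyk, -⟩ := htail q
      have : 0 ≤ (k : ℝ) * B := by positivity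
      rw [h0, Nat.cast_zero]
      linarith
    simp [softCount, this]
  have h3 : P.softCount Finset.univ Finset.univ ≤
      ((Finset.univ.filter fun ω : C → Fin t =>
        ∀ q, (P.load q Finset.univ ω : ℝ) ≤ P.thr q).card : ℝ) := by
    rw [← Finset.sum_boole]
    refine Finset.sum_le_sum fun ω _ => ?_
    split_ifs with hω
    · exact Finset.prod_le_one (fun _ _ => cutoff_nonneg _ _ _) fun _ _ => cutoff_le_one _ _ _
    · push Not at hω
      obtain ⟨q, hq⟩ := hω
      exact (Finset.prod_eq_zero (Finset.mem_univ q) (cutoff_eq_zero hgap hq.le)).le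
  rw [← h2]
  exact h1.trans (mul_le_mul_of_nonneg_left h3 (by positivity))

end PatternSystem

/-! ### Profiles of edges and numerical estimates -/

theorem one_add_pow_le (m : ℕ) {x : ℝ} (hx : 0 ≤ x) :
    (1 + x) ^ m ≤ 1 + m * x * (1 + x) ^ m := by
  induction m with
  | zero => simp
  | succ m ih =>
    have h : (1 + x) ^ m ≤ (1 + x) ^ (m + 1) := pow_le_pow_right₀ (by linarith) (Nat.le_succ m)
    have h1 : ((m + 1 : ℕ) * x) * (1 + x) ^ m ≤ ((m + 1 : ℕ) * x) * (1 + x) ^ (m + 1) :=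
      mul_le_mul_of_nonneg_left h (by positivity)
    calc (1 + x) ^ (m + 1) = (1 + x) ^ m + x * (1 + x) ^ m := by ring
      _ ≤ 1 + ((m + 1 : ℕ) * x) * (1 + x) ^ m := by push_cast; linarith
      _ ≤ _ := by linarith

theorem one_add_pow_le_six_fifths {m : ℕ} {x : ℝ} (hx : 0 ≤ x) (h : m * x ≤ 1 / 6) :
    (1 + x) ^ m ≤ 6 / 5 := by
  have h1 := one_add_pow_le m hx
  have h2 : 0 < (1 + x) ^ m := by positivity
  nlinarith

section Profile

variable {C E J : Type*} {t Δ : ℕ}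
  (c : E → Finset C) (hc : ∀ e, (c e).card = Δ)

/-- The classes of the colours of `e`, in a fixed order. -/
noncomputable def profile (ω : C → Fin t) (e : E) : Fin Δ → Fin t := fun i =>
  ω (((c e).equivFinOfCardEq (hc e)).symm i)

theorem profile_eq_iff (ω : C → Fin t) (e : E) (τ : Fin Δ → Fin t) :
    profile c hc ω e = τ ↔
      ∀ α, ∀ h : α ∈ c e, ω α = τ ((c e).equivFinOfCardEq (hc e) ⟨α, h⟩) := by
  constructor
  · rintro rfl α h
    simp [profile]
  · intro h
    funext i
    have := h _ (((c e).equivFinOfCardEq (hc e)).symm i).2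
    simpa [profile] using this

theorem card_filter_profile (ω : C → Fin t) (e : E) (p : Fin t → Prop) [DecidablePred p] :
    (Finset.univ.filter fun i => p (profile c hc ω e i)).card =
      ((c e).filter fun α => p (ω α)).card := by
  refine Finset.card_bij' (fun i _ => (((c e).equivFinOfCardEq (hc e)).symm i : C))
    (fun α hα => (c e).equivFinOfCardEq (hc e) ⟨α, (Finset.mem_filter.1 hα).1⟩) ?_ ?_ ?_ ?_
  · intro i hi
    exact Finset.mem_filter.2 ⟨Subtype.coe_prop _, (Finset.mem_filter.1 hi).2⟩
  · intro α hα
    refine Finset.mem_filter.2 ⟨Finset.mem_univ _, ?_⟩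
    simpa [profile] using (Finset.mem_filter.1 hα).2
  · intro i hi
    simp
  · intro α hα
    simp

/-- The patterns are the edges together with a profile; the constraints bound the number of
edges with a given profile in the sets `F j`. -/
noncomputable def profileSystem [DecidableEq C] (ht : 1 ≤ t) (F : J → Finset E) (D gap : ℝ) :
    PatternSystem C (E × (Fin Δ → Fin t)) (J × (Fin Δ → Fin t)) t where
  dom p := c p.1
  val p α := if h : α ∈ c p.1 then p.2 ((c p.1).equivFinOfCardEq (hc p.1) ⟨α, h⟩) else ⟨0, ht⟩
  fam q := F q.1 ×ˢ {q.2}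
  thr q := (F q.1).card / (t : ℝ) ^ Δ + D
  gap := gap

theorem card_filter_product_singleton {A B : Type*} (s : Finset A) (b : B) (p : A → Prop)
    [DecidablePred p] :
    ((s ×ˢ {b}).filter fun x : A × B => p x.1).card = (s.filter p).card := by
  rw [Finset.product_singleton, Finset.filter_map, Finset.card_map]
  rfl

theorem load_profileSystem [Fintype C] [DecidableEq C] (ht : 1 ≤ t) (F : J → Finset E) (D gap : ℝ)
    (j : J) (τ : Fin Δ → Fin t) (ω : C → Fin t) :
    (profileSystem c hc ht F D gap).load (j, τ) Finset.univ ω =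
      ((F j).filter fun e => profile c hc ω e = τ).card := by
  unfold PatternSystem.load profileSystem
  rw [← card_filter_product_singleton (F j) τ]
  congr 1
  refine Finset.filter_congr fun p hp => ?_
  have hp2 : p.2 = τ := by simpa using (Finset.mem_product.1 hp).2
  rw [profile_eq_iff]
  simp only [Finset.subset_univ, true_and]
  refine forall₂_congr fun α hα => ?_
  rw [dif_pos hα, hp2]

/-- Take `k = ⌊K / (8 * B)⌋`, which is at least `K / (16 * B)` because `8 * B ≤ K`. Bernoulli's
inequality gives `(1 + K / (8 * M')) ^ k ≥ 1 + K ^ 2 / (128 * B * M') ≥ 2`. -/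
theorem exists_pow_le_half {M M' K B : ℝ} (hM0 : 0 ≤ M) (hMle : M ≤ M') (hM'0 : 0 < M')
    (hB0 : 0 < B) (hKB : 8 * B ≤ K) (hKK : 128 * B * M' ≤ K ^ 2) :
    ∃ k : ℕ, k * B ≤ K / 8 ∧ (M / (M + K / 8)) ^ k ≤ 1 / 2 := by
  have hK0 : 0 < K := by linarith
  have hfloor1 : (⌊K / 8 / B⌋₊ : ℝ) ≤ K / 8 / B := Nat.floor_le (by positivity)
  have hfloor2 : K / 8 / B / 2 ≤ (⌊K / 8 / B⌋₊ : ℝ) := by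
    have h1 : 1 ≤ K / 8 / B := by
      rw [div_div, le_div_iff₀ (by positivity)]
      linarith
    have h2 : (1 : ℝ) ≤ ⌊K / 8 / B⌋₊ := by
      exact_mod_cast Nat.le_floor (n := 1) (by rwa [Nat.cast_one])
    have h3 := Nat.lt_floor_add_one (K / 8 / B)
    linarith
  refine ⟨⌊K / 8 / B⌋₊, by rwa [← le_div_iff₀ hB0], ?_⟩
  generalize ⌊K / 8 / B⌋₊ = k at *
  have h1 : M / (M + K / 8) ≤ 1 / (1 + K / (8 * M')) := by
    rw [div_le_div_iff₀ (by linarith) (by positivity)]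
    have : M * (K / (8 * M')) ≤ K / 8 := by
      rw [mul_div_assoc', div_le_iff₀ (by positivity)]
      nlinarith
    linarith
  refine (pow_le_pow_left₀ (by positivity) h1 k).trans ?_
  rw [div_pow, one_pow]
  refine one_div_le_one_div_of_le (by norm_num) ?_
  have h2 : 0 ≤ K / (8 * M') := by positivity
  have h3 := one_add_mul_le_pow (a := K / (8 * M')) (by linarith) k
  have h4 : 1 ≤ k * (K / (8 * M')) := by
    refine le_trans ?_ (mul_le_mul_of_nonneg_right hfloor2 h2)
    rw [div_div, div_div, div_mul_div_comm, le_div_iff₀ (by positivity)]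
    linarith
  linarith

/-- Numerical form of the tail condition. -/
theorem exists_tail_parameters {t Δ n r m : ℕ} {μ d κ : ℝ} (ht : 2 ≤ t) (hΔ : 1 ≤ Δ) (hn : 1 ≤ n)
    (hr : 1 ≤ r) (hμ : μ ∈ Set.Ioc (0 : ℝ) 1) (hd : d ∈ Set.Ioc (0 : ℝ) 1)
    (hκ : 0 ≤ κ) (hκ2 : κ ^ 2 = 16 * ((t : ℝ) ^ Δ * d⁻¹ * μ)) (hκΔ : (1 + κ) ^ Δ ≤ 6 / 5)
    (hm : m ≤ n) :
    ∃ y : ℝ, ∃ k : ℕ, 0 < y ∧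
      y + k * (Δ * μ * n) ≤ m / (t : ℝ) ^ Δ + 2 ^ Δ * κ * r * n - κ * r * n / 2 ∧
      (m * ((1 + κ) / t) ^ Δ / y) ^ k ≤ 1 / 2 := by
  obtain ⟨hμ0, hμ1⟩ := hμ
  obtain ⟨hd0, hd1⟩ := hd
  have ht' : (2 : ℝ) ≤ t := by exact_mod_cast ht
  have hn' : (1 : ℝ) ≤ n := by exact_mod_cast hn
  have hr' : (1 : ℝ) ≤ r := by exact_mod_cast hr
  have hΔ' : (1 : ℝ) ≤ Δ := by exact_mod_cast hΔ
  have hm' : (m : ℝ) ≤ n := by exact_mod_cast hm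
  have hΔ2 : (2 : ℝ) * Δ ≤ 2 ^ Δ := by
    have : 2 * Δ ≤ 2 ^ Δ := by
      obtain ⟨k, rfl⟩ := Nat.exists_eq_add_of_le' hΔ
      have := Nat.lt_two_pow_self (n := k)
      rw [pow_succ]; omega
    exact_mod_cast this
  set b : ℝ := 2 ^ Δ with hb
  have hbt : b ≤ (t : ℝ) ^ Δ := pow_le_pow_left₀ (by norm_num) ht' Δ
  set p : ℝ := (t : ℝ) ^ Δ with hp
  have hb2 : 2 ≤ b := by linarith
  have hp0 : 0 < p := by linarith
  have hdinv : 1 ≤ d⁻¹ := (one_le_inv₀ hd0).2 hd1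
  have hpd : p ≤ p * d⁻¹ := le_mul_of_one_le_right hp0.le hdinv
  have hκp : 16 * (p * μ) ≤ κ ^ 2 := by
    rw [hκ2]
    nlinarith [mul_le_mul_of_nonneg_right hpd hμ0.le]
  have hκμ : 4 * μ ≤ κ := by
    refine abs_le_of_sq_le_sq' ?_ hκ |>.2
    nlinarith [mul_le_mul_of_nonneg_right (hb2.trans hbt) hμ0.le]
  have hκ0 : 0 < κ := by linarith
  -- `K` is the allowed excess over the mean. It has to absorb the inflation of the mean by `(1 + κ)
  -- ^ Δ`, the margin in `y`, the `k` deletions of size `B`, and the gap.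
  set K : ℝ := b * κ * r * n with hK
  have hκrn : 0 < κ * r * n := by positivity
  have hKκ : 2 * (κ * r * n) ≤ K := by
    rw [hK]; nlinarith
  have hK0 : 0 < K := by linarith
  have hB0 : 0 < Δ * μ * n := by positivity
  set B : ℝ := Δ * μ * n with hB
  have hKB : 8 * B ≤ K := by
    have h1 : Δ * (4 * μ) ≤ Δ * κ := mul_le_mul_of_nonneg_left hκμ (by linarith)
    have h2 : 2 * Δ * κ ≤ b * κ := mul_le_mul_of_nonneg_right hΔ2 hκ
    have h3 : 8 * (Δ * μ) ≤ b * κ := by linarith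
    have h4 : 8 * (Δ * μ) * n ≤ b * κ * n := mul_le_mul_of_nonneg_right h3 (by linarith)
    have h5 : b * κ * n ≤ b * κ * n * r := le_mul_of_one_le_right (by positivity) hr'
    rw [hK, hB]
    linarith
  set M : ℝ := m * ((1 + κ) / t) ^ Δ with hM
  have hMp : M = m * (1 + κ) ^ Δ / p := by rw [hM, div_pow, mul_div_assoc]
  have hM0 : 0 ≤ M := by rw [hMp]; positivity
  have hMle : M ≤ 6 / 5 * n / p := by
    rw [hMp]
    refine div_le_div_of_nonneg_right ?_ hp0.le
    nlinarith [Nat.cast_nonneg (α := ℝ) m]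
  have hMmean : M ≤ m / p + 3 / 10 * K := by
    have h1 := one_add_pow_le Δ hκ
    have h2 : (1 + κ) ^ Δ ≤ 1 + 6 / 5 * (Δ * κ) := by
      have : Δ * κ * (1 + κ) ^ Δ ≤ Δ * κ * (6 / 5) :=
        mul_le_mul_of_nonneg_left hκΔ (by positivity)
      linarith
    have h3 : M ≤ m * (1 + 6 / 5 * (Δ * κ)) / p := by
      rw [hMp]
      exact div_le_div_of_nonneg_right (mul_le_mul_of_nonneg_left h2 (by positivity)) hp0.le
    have h4 : m * (6 / 5 * (Δ * κ)) / p ≤ 3 / 10 * K := by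
      rw [div_le_iff₀ hp0]
      have h5 : m * (Δ * κ) ≤ n * (Δ * κ) := mul_le_mul_of_nonneg_right hm' (by positivity)
      have h6 : n * κ * (2 * Δ) ≤ n * κ * p :=
        mul_le_mul_of_nonneg_left (hΔ2.trans hbt) (by positivity)
      have h7 : 2 * (n * κ) ≤ K := by
        refine le_trans ?_ hKκ
        have := le_mul_of_one_le_right (show 0 ≤ κ * n by positivity) hr'
        linarith
      have h8 := mul_le_mul_of_nonneg_right h7 hp0.le
      linarith
    have h5 : m * (1 + 6 / 5 * (Δ * κ)) / p = m / p + m * (6 / 5 * (Δ * κ)) / p := by ring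
    linarith
  have hKK : 128 * B * (6 / 5 * n / p) ≤ K ^ 2 := by
    have h1 : K ^ 2 = b ^ 2 * κ ^ 2 * r ^ 2 * n ^ 2 := by rw [hK]; ring
    have h2 : b ^ 2 * (16 * (p * μ)) * n ^ 2 ≤ K ^ 2 := by
      rw [h1]
      have h3 : b ^ 2 * (16 * (p * μ)) ≤ b ^ 2 * κ ^ 2 :=
        mul_le_mul_of_nonneg_left hκp (by positivity)
      have h4 : b ^ 2 * κ ^ 2 ≤ b ^ 2 * κ ^ 2 * r ^ 2 :=
        le_mul_of_one_le_right (by positivity) (one_le_pow₀ hr')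
      exact mul_le_mul_of_nonneg_right (h3.trans h4) (by positivity)
    refine le_trans ?_ h2
    rw [mul_div_assoc', div_le_iff₀ hp0]
    have h5 : b ^ 2 * b ^ 2 ≤ b ^ 2 * p ^ 2 :=
      mul_le_mul_of_nonneg_left (pow_le_pow_left₀ (by linarith) hbt 2) (by positivity)
    have h7 : 16 * Δ ≤ b ^ 2 * b ^ 2 := by
      have h8 : (2 * Δ) * 8 ≤ b * b ^ 3 := by
        have : (8 : ℝ) ≤ b ^ 3 := by
          have := pow_le_pow_left₀ (by norm_num) hb2 3
          norm_num at this
          exact this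
        exact mul_le_mul hΔ2 this (by norm_num) (by linarith)
      linarith [show b * b ^ 3 = b ^ 2 * b ^ 2 by ring]
    have h9 : 16 * Δ * (μ * n ^ 2) ≤ b ^ 2 * p ^ 2 * (μ * n ^ 2) :=
      mul_le_mul_of_nonneg_right (h7.trans h5) (by positivity)
    have h10 : 0 ≤ (Δ : ℝ) * (μ * n ^ 2) := by positivity
    rw [hB]
    linarith
  obtain ⟨k, hk, hhalf⟩ := exists_pow_le_half hM0 hMle (by positivity) hB0 hKB hKK
  -- The budget: `y + k * B` is at most the mean plus `(3/10 + 1/8 + 1/8) * K`, while the gap `κ * r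
  -- * n / 2` is at most `K / 4` and so leaves `3/4 * K`.
  exact ⟨M + K / 8, k, by linarith, by linarith, hhalf⟩

/-- Simultaneous upper bounds for the numbers of edges with given profiles. -/
theorem pow_card_le_mul_card_profile [Fintype C] [DecidableEq C] [Fintype E] [Fintype J]
    {n r : ℕ} {μ d κ : ℝ} (hn : 1 ≤ n) (ht : 1 ≤ t) (hΔ : 1 ≤ Δ) (hr : 1 ≤ r)
    (hμ : μ ∈ Set.Ioc (0 : ℝ) 1) (hd : d ∈ Set.Ioc (0 : ℝ) 1)
    (hκ : κ = 4 * √((t : ℝ) ^ Δ * d⁻¹ * μ)) (hκΔ : (Δ + 1) * κ ≤ 1 / 6)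
    (hbdd : ∀ α, ((Finset.univ.filter fun e => α ∈ c e).card : ℝ) ≤ μ * n)
    (F : J → Finset E) (hF : ∀ j, (F j).card ≤ n)
    (hFsum : ∀ α, ∑ j, (((F j).filter fun e => α ∈ c e).card : ℝ) ≤ 2 * (μ * n)) :
    (t : ℝ) ^ Fintype.card C ≤ (1 + κ) ^ Fintype.card C *
      (Finset.univ.filter fun ω : C → Fin t => ∀ j τ,
        (((F j).filter fun e => profile c hc ω e = τ).card : ℝ) ≤
          (F j).card / (t : ℝ) ^ Δ + 2 ^ Δ * κ * r * n).card := by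
  classical
  obtain ⟨hμ0, hμ1⟩ := hμ
  obtain ⟨hd0, hd1⟩ := hd
  have ht' : (1 : ℝ) ≤ t := by exact_mod_cast ht
  have hn' : (1 : ℝ) ≤ n := by exact_mod_cast hn
  have hr' : (1 : ℝ) ≤ r := by exact_mod_cast hr
  have harg : 0 < (t : ℝ) ^ Δ * d⁻¹ * μ := by positivity
  have hκ0 : 0 < κ := by rw [hκ]; positivity
  have hκ2 : κ ^ 2 = 16 * ((t : ℝ) ^ Δ * d⁻¹ * μ) := by
    rw [hκ, mul_pow, Real.sq_sqrt harg.le]; norm_num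
  -- For `t = 1` the threshold is at least the total number of edges, so every map is good. The tail
  -- estimate relies on `2 ^ Δ ≤ t ^ Δ` and is kept for `t ≥ 2`.
  rcases ht.eq_or_lt with rfl | ht2
  · have h1 : (Finset.univ.filter fun ω : C → Fin 1 => ∀ j τ,
        (((F j).filter fun e => profile c hc ω e = τ).card : ℝ) ≤
          (F j).card / ((1 : ℕ) : ℝ) ^ Δ + 2 ^ Δ * κ * r * n) = Finset.univ := by
      refine Finset.filter_true_of_mem fun ω _ j τ => ?_
      have h2 : (((F j).filter fun e => profile c hc ω e = τ).card : ℝ) ≤ (F j).card := by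
        exact_mod_cast Finset.card_filter_le _ _
      have h3 : 0 ≤ 2 ^ Δ * κ * r * n := by positivity
      rw [Nat.cast_one, one_pow, div_one]
      linarith
    rw [h1]
    simpa using one_le_pow₀ (a := 1 + κ) (by linarith)
  have hκm : (1 + κ) ^ (Δ + 1) ≤ 6 / 5 :=
    one_add_pow_le_six_fifths hκ0.le (by push_cast; exact hκΔ)
  have hκm' : (1 + κ) ^ Δ ≤ 6 / 5 :=
    (pow_le_pow_right₀ (by linarith) (Nat.le_succ Δ)).trans hκm
  -- `B` bounds the edges sharing a colour with a given edge: `Δ` colours, each on at most `μ * n`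
  -- edges.
  have key := (profileSystem c hc ht F (2 ^ Δ * κ * r * n) (κ * r * n / 2)).pow_card_le_mul_card_good
    (κ := κ) (Δ := Δ) (B := Δ * μ * n) hκ0.le ht
    (by change 0 < κ * r * n / 2; positivity) hΔ (fun p => hc p.1) (by positivity) ?_ ?_ ?_
  · refine key.trans (le_of_eq ?_)
    congr 3
    refine Finset.filter_congr fun ω _ => ?_
    rw [Prod.forall]
    refine forall₂_congr fun j τ => ?_
    rw [load_profileSystem]
    rfl
  · intro q p
    change ((((F q.1 ×ˢ {q.2}).filter fun f : E × (Fin Δ → Fin t) =>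
      ¬ Disjoint (c f.1) (c p.1))).card : ℝ) ≤ _
    rw [card_filter_product_singleton (F q.1) q.2 (fun f => ¬ Disjoint (c f) (c p.1))]
    have hsub : ((F q.1).filter fun f => ¬ Disjoint (c f) (c p.1)) ⊆
        (c p.1).biUnion fun α => Finset.univ.filter fun e => α ∈ c e := by
      intro f hf
      obtain ⟨α, h1, h2⟩ := Finset.not_disjoint_iff.1 (Finset.mem_filter.1 hf).2
      exact Finset.mem_biUnion.2 ⟨α, h2, Finset.mem_filter.2 ⟨Finset.mem_univ _, h1⟩⟩
    have h1 : (((F q.1).filter fun f => ¬ Disjoint (c f) (c p.1)).card : ℝ) ≤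
        ∑ α ∈ c p.1, ((Finset.univ.filter fun e => α ∈ c e).card : ℝ) := by
      exact_mod_cast (Finset.card_le_card hsub).trans Finset.card_biUnion_le
    refine h1.trans ((Finset.sum_le_sum fun α _ => hbdd α).trans (le_of_eq ?_))
    rw [Finset.sum_const, hc, nsmul_eq_mul]
    ring
  · intro q
    change ∃ y : ℝ, ∃ k : ℕ, 0 < y ∧ y + k * (Δ * μ * n) ≤
      (F q.1).card / (t : ℝ) ^ Δ + 2 ^ Δ * κ * r * n - κ * r * n / 2 ∧
      ((F q.1 ×ˢ {q.2}).card * ((1 + κ) / t) ^ Δ / y) ^ k ≤ 1 / 2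
    rw [Finset.card_product, Finset.card_singleton, mul_one]
    exact exists_tail_parameters ht2 hΔ hn hr ⟨hμ0, hμ1⟩ ⟨hd0, hd1⟩ hκ0.le hκ2 hκm' (hF q.1)
  · intro a
    change 2 * (1 + κ) * ((1 + κ) / t) ^ Δ *
      ∑ q : J × (Fin Δ → Fin t), (((F q.1 ×ˢ {q.2}).filter fun f : E × (Fin Δ → Fin t) =>
      a ∈ c f.1).card : ℝ) ≤ κ * (κ * r * n / 2)
    simp_rw [card_filter_product_singleton (F _) _ (fun f => a ∈ c f)]
    rw [Fintype.sum_prod_type]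
    simp_rw [Finset.sum_const, nsmul_eq_mul]
    rw [← Finset.mul_sum, Finset.card_univ, Fintype.card_fun, Fintype.card_fin, Fintype.card_fin]
    have h0 : (0 : ℝ) < (t : ℝ) ^ Δ := by positivity
    have h1 := hFsum a
    have h2 : 16 * μ ≤ κ ^ 2 := by
      have h3 : (1 : ℝ) ≤ (t : ℝ) ^ Δ * d⁻¹ :=
        one_le_mul_of_one_le_of_one_le (one_le_pow₀ ht') ((one_le_inv₀ hd0).2 hd1)
      rw [hκ2]
      nlinarith
    set s := ∑ j, (((F j).filter fun e => a ∈ c e).card : ℝ)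
    -- The number `t ^ Δ` of profiles cancels the probability `t ^ (-Δ)` of each. What remains is at
    -- most `24/5 * μ * n`, below `8 * μ * n ≤ κ ^ 2 / 2 * n`.
    have h4 : 2 * (1 + κ) * ((1 + κ) / t) ^ Δ * (((t ^ Δ : ℕ) : ℝ) * s) =
        2 * (1 + κ) ^ (Δ + 1) * s := by
      rw [div_pow]
      push_cast
      field_simp
      ring
    rw [h4]
    have hs : 0 ≤ s := Finset.sum_nonneg fun _ _ => by positivity
    calc 2 * (1 + κ) ^ (Δ + 1) * s ≤ 2 * (6 / 5) * s := by gcongr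
      _ ≤ 2 * (6 / 5) * (2 * (μ * n)) := by gcongr
      _ ≤ κ ^ 2 / 2 * n := by nlinarith
      _ ≤ κ ^ 2 / 2 * n * r := le_mul_of_one_le_right (by positivity) hr'
      _ = _ := by ring

/-- Summing the upper bounds over `T` loses at most `t ^ Δ * D`. The lower bound is the same
estimate for `Tᶜ`, since the two counts add up to `A.card`. -/
theorem abs_card_profile_mem_sub_le (ht : 1 ≤ t) (ω : C → Fin t) (A : Finset E) {D : ℝ}
    (h : ∀ τ, ((A.filter fun e => profile c hc ω e = τ).card : ℝ) ≤ A.card / (t : ℝ) ^ Δ + D)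
    (hD : 0 ≤ D) (T : Finset (Fin Δ → Fin t)) :
    |((A.filter fun e => profile c hc ω e ∈ T).card : ℝ) - T.card * ((t : ℝ) ^ Δ)⁻¹ * A.card| ≤
      (t : ℝ) ^ Δ * D := by
  classical
  have ht' : (0 : ℝ) < (t : ℝ) ^ Δ := by
    have : (0 : ℝ) < t := by exact_mod_cast ht
    positivity
  have hup : ∀ T : Finset (Fin Δ → Fin t), ((A.filter fun e => profile c hc ω e ∈ T).card : ℝ) ≤
      T.card * ((t : ℝ) ^ Δ)⁻¹ * A.card + (t : ℝ) ^ Δ * D := by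
    intro T
    have h1 : (A.filter fun e => profile c hc ω e ∈ T).card =
        ∑ τ ∈ T, (A.filter fun e => profile c hc ω e = τ).card := by
      rw [Finset.card_eq_sum_card_fiberwise (f := profile c hc ω) (t := T)
        (s := A.filter fun e => profile c hc ω e ∈ T) (fun e he => (Finset.mem_filter.1 he).2)]
      refine Finset.sum_congr rfl fun τ hτ => ?_
      congr 1
      ext e
      simp only [Finset.mem_filter]
      constructor
      · rintro ⟨⟨h1, -⟩, h3⟩; exact ⟨h1, h3⟩
      · rintro ⟨h1, rfl⟩; exact ⟨⟨h1, hτ⟩, rfl⟩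
    have h2 : (T.card : ℝ) ≤ (t : ℝ) ^ Δ := by
      have := Finset.card_le_univ T
      rw [Fintype.card_fun, Fintype.card_fin, Fintype.card_fin] at this
      exact_mod_cast this
    rw [h1]
    push_cast
    refine (Finset.sum_le_sum fun τ _ => h τ).trans ?_
    rw [Finset.sum_const, nsmul_eq_mul]
    have := mul_le_mul_of_nonneg_right h2 hD
    rw [div_eq_mul_inv]
    linarith
  have hc1 : ((A.filter fun e => profile c hc ω e ∈ T).card : ℝ) +
      (A.filter fun e => profile c hc ω e ∈ Tᶜ).card = A.card := by
    simp only [Finset.mem_compl]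
    exact_mod_cast Finset.card_filter_add_card_filter_not (s := A) (fun e => profile c hc ω e ∈ T)
  have hc2 : (T.card : ℝ) + (Tᶜ.card : ℝ) = (t : ℝ) ^ Δ := by
    have := Finset.card_add_card_compl T
    rw [Fintype.card_fun, Fintype.card_fin, Fintype.card_fin] at this
    exact_mod_cast this
  have hc3 : (T.card : ℝ) * ((t : ℝ) ^ Δ)⁻¹ * A.card + Tᶜ.card * ((t : ℝ) ^ Δ)⁻¹ * A.card
      = A.card := by
    rw [← add_mul, ← add_mul, hc2, mul_inv_cancel₀ ht'.ne', one_mul]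
  have h1 := hup T
  have h2 := hup Tᶜ
  rw [abs_le]
  constructor <;> linarith

end Profile

/-! ### Multinomial counts and the law of the splitting -/

/-- The number of functions with prescribed fibre sizes is a multinomial coefficient. -/
theorem card_filter_fibre_card_eq_multinomial {ι β : Type*} [Fintype ι] [Fintype β]
    [DecidableEq ι] [DecidableEq β] (s : β → ℕ) (hs : ∑ j, s j = Fintype.card ι)
    [DecidablePred fun τ : ι → β => ∀ j, (Finset.univ.filter fun i => τ i = j).card = s j] :
    (Finset.univ.filter fun τ : ι → β =>
      ∀ j, (Finset.univ.filter fun i => τ i = j).card = s j).card =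
      Nat.multinomial Finset.univ s := by
  -- Expand the power of `∑ j, X j` both as a sum over all maps and by the multinomial theorem, then
  -- compare the coefficients at the exponent `s`.
  have h := Finset.prod_univ_sum (fun _ : ι => (Finset.univ : Finset β))
    (fun _ j => (MvPolynomial.X j : MvPolynomial β ℕ))
  rw [Finset.prod_const, Finset.card_univ, Finset.sum_pow_eq_sum_piAntidiag,
    Fintype.piFinset_univ] at h
  have hmon : ∀ k : β → ℕ, ∏ j, (MvPolynomial.X j : MvPolynomial β ℕ) ^ k j =
      MvPolynomial.monomial (Finsupp.equivFunOnFinite.symm k) 1 := by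
    intro k
    rw [MvPolynomial.monomial_eq, Finsupp.prod_fintype _ _ (fun _ => pow_zero _)]
    simp
  have hfib : ∀ τ : ι → β, ∏ i, (MvPolynomial.X (τ i) : MvPolynomial β ℕ) =
      MvPolynomial.monomial (Finsupp.equivFunOnFinite.symm
        fun j => (Finset.univ.filter fun i => τ i = j).card) 1 := by
    intro τ
    rw [← hmon, ← Finset.prod_fiberwise (s := Finset.univ) (g := τ)]
    refine Finset.prod_congr rfl fun j _ => ?_
    rw [Finset.prod_congr rfl (g := fun _ => MvPolynomial.X j)
      (fun i hi => by rw [(Finset.mem_filter.1 hi).2]), Finset.prod_const]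
  simp_rw [hmon, hfib] at h
  have h' := congrArg (MvPolynomial.coeff (Finsupp.equivFunOnFinite.symm s)) h
  rw [MvPolynomial.coeff_sum, MvPolynomial.coeff_sum] at h'
  simp_rw [← MvPolynomial.C_eq_coe_nat, MvPolynomial.coeff_C_mul, MvPolynomial.coeff_monomial,
    EmbeddingLike.apply_eq_iff_eq] at h'
  rw [Finset.sum_eq_single s (by intro b _ hb; simp [hb])
    (fun hn => absurd (Finset.mem_piAntidiag.2 ⟨hs, fun _ _ => Finset.mem_univ _⟩) hn)] at h'
  rw [if_pos rfl, mul_one] at h'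
  rw [← Nat.cast_id (Nat.multinomial Finset.univ s), h', Finset.sum_boole]
  simp [funext_iff]

theorem splitMeasure_real_filter {C : Type*} [Fintype C] [DecidableEq C] {t : ℕ}
    (p : (C → Fin t) → Prop) [DecidablePred p] :
    (splitMeasure C t).real {ω | p ω} =
      (Finset.univ.filter p).card / (t : ℝ) ^ Fintype.card C := by
  have h : splitMeasure C t = ProbabilityTheory.uniformOn (Set.univ : Set (C → Fin t)) := by
    rw [splitMeasure, ← ProbabilityTheory.uniformOn_pi, Set.pi_univ]
  rw [h, Measure.real, ProbabilityTheory.uniformOn_univ, ENNReal.toReal_div,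
    show {ω | p ω} = ((Finset.univ.filter p : Finset (C → Fin t)) : Set (C → Fin t)) by ext; simp,
    Measure.count_apply_finset]
  simp

theorem splitMeasure_ne_top {C : Type*} [Fintype C] {t : ℕ} (ht : 1 ≤ t)
    (A : Set (C → Fin t)) : splitMeasure C t A ≠ ⊤ := by
  have hfin : splitMeasure C t Set.univ ≠ ⊤ := by
    rw [splitMeasure, Measure.pi_univ]
    exact ENNReal.prod_ne_top fun _ _ => by
      rw [ProbabilityTheory.uniformOn_of_univ Set.finite_univ ⟨⟨0, ht⟩, trivial⟩]
      exact ENNReal.one_ne_top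
  exact ne_top_of_le_ne_top hfin (measure_mono (Set.subset_univ _))

/-! ### The threshold functions -/

section Threshold

theorem isThreshold_id : IsThreshold id :=
  ⟨Set.mapsTo_id _, strictMono_id.strictMonoOn _⟩

/-- A threshold function below which `κ` is small compared to `1 / Δ`. -/
noncomputable def smallness (x : ℝ) : ℝ := x ^ (3 + 1 / x) / 2304

theorem isThreshold_smallness : IsThreshold smallness := by
  constructor
  · rintro x ⟨hx0, hx1⟩
    have h1 : 0 < x ^ (3 + 1 / x) := Real.rpow_pos_of_pos hx0 _
    have h2 : x ^ (3 + 1 / x) ≤ 1 := Real.rpow_le_one hx0.le hx1 (by positivity)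
    constructor
    · unfold smallness; positivity
    · unfold smallness; linarith
  · rintro x ⟨hx0, hx1⟩ y ⟨hy0, hy1⟩ hxy
    unfold smallness
    -- Both changes increase the value: the base grows, and the exponent `3 + 1 / x` shrinks over a
    -- base of at most `1`.
    have h1 : x ^ (3 + 1 / x) < y ^ (3 + 1 / x) :=
      Real.rpow_lt_rpow hx0.le hxy (by positivity)
    have h2 : y ^ (3 + 1 / x) ≤ y ^ (3 + 1 / y) := by
      refine Real.rpow_le_rpow_of_exponent_ge hy0 hy1 ?_
      have := one_div_le_one_div_of_le hx0 hxy.le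
      linarith
    linarith

/-- Let `m` be the least of `1 / t`, `d`, `1 / Δ`. Then `t ^ Δ`, `d⁻¹` and `Δ ^ 2` are at most `m ^
(-1 / m)`, `m⁻¹` and `m ^ (-2)`, which accounts for the exponent `3 + 1 / m` in `smallness`. As
`2304 = 48 ^ 2`, this yields `Δ * κ ≤ 4 / 48`, and `Δ + 1 ≤ 2 * Δ`. -/
theorem mul_le_of_le_smallness {t Δ : ℕ} {μ d κ : ℝ} (ht : 1 ≤ t) (hΔ : 1 ≤ Δ)
    (hμ : μ ∈ Set.Ioc (0 : ℝ) 1) (hd : d ∈ Set.Ioc (0 : ℝ) 1)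
    (h1 : μ ≤ smallness (1 / (t : ℝ))) (h2 : μ ≤ smallness d)
    (h3 : μ ≤ smallness (1 / (Δ : ℝ))) (hκ : κ = 4 * √((t : ℝ) ^ Δ * d⁻¹ * μ)) :
    (Δ + 1) * κ ≤ 1 / 6 := by
  obtain ⟨hd0, hd1⟩ := hd
  have ht' : (1 : ℝ) ≤ t := by exact_mod_cast ht
  have hΔ' : (1 : ℝ) ≤ Δ := by exact_mod_cast hΔ
  set m : ℝ := min (1 / (t : ℝ)) (min d (1 / (Δ : ℝ))) with hm
  have hmμ : μ ≤ smallness m := by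
    rcases min_choice (1 / (t : ℝ)) (min d (1 / (Δ : ℝ))) with h | h
    · rwa [hm, h]
    · rcases min_choice d (1 / (Δ : ℝ)) with h' | h'
      · rwa [hm, h, h']
      · rwa [hm, h, h']
  have hm0 : 0 < m := lt_min (by positivity) (lt_min hd0 (by positivity))
  have hmd : m ≤ d := (min_le_right _ _).trans (min_le_left _ _)
  have hm1 : m ≤ 1 := hmd.trans hd1
  have htm : (t : ℝ) ≤ m⁻¹ := by
    rw [le_inv_comm₀ (by positivity) hm0, ← one_div]
    exact min_le_left _ _
  have hΔm : (Δ : ℝ) ≤ m⁻¹ := by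
    rw [le_inv_comm₀ (by positivity) hm0, ← one_div]
    exact (min_le_right _ _).trans (min_le_right _ _)
  have hdm : d⁻¹ ≤ m⁻¹ := inv_anti₀ hm0 hmd
  have hminv : 1 ≤ m⁻¹ := (one_le_inv₀ hm0).2 hm1
  have htpow : (t : ℝ) ^ Δ ≤ (m⁻¹) ^ (1 / m) := by
    rw [← Real.rpow_natCast]
    refine (Real.rpow_le_rpow (by positivity) htm (by positivity)).trans ?_
    exact Real.rpow_le_rpow_of_exponent_le hminv (by rwa [one_div])
  have hprod : (t : ℝ) ^ Δ * d⁻¹ * μ * Δ ^ 2 ≤ 1 / 2304 := by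
    calc (t : ℝ) ^ Δ * d⁻¹ * μ * Δ ^ 2
        ≤ (m⁻¹) ^ (1 / m) * m⁻¹ * smallness m * (m⁻¹) ^ 2 := by
          have hμ0 := hμ.1
          have hg0 : 0 ≤ smallness m := hμ0.le.trans hmμ
          gcongr
      _ = 1 / 2304 := by
          unfold smallness
          rw [Real.inv_rpow hm0.le, Real.rpow_add hm0]
          have h4 : m ^ (3 : ℝ) = m ^ 3 := by exact_mod_cast Real.rpow_natCast m 3
          have h5 : m ^ (1 / m) ≠ 0 := (Real.rpow_pos_of_pos hm0 _).ne'
          rw [h4]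
          field_simp
  have harg : 0 ≤ (t : ℝ) ^ Δ * d⁻¹ * μ := by have := hμ.1; positivity
  have hsq : √((t : ℝ) ^ Δ * d⁻¹ * μ) * Δ ≤ 1 / 48 := by
    refine abs_le_of_sq_le_sq' ?_ (by norm_num) |>.2
    rw [mul_pow, Real.sq_sqrt harg]
    norm_num at hprod ⊢
    exact hprod
  have hs0 := Real.sqrt_nonneg ((t : ℝ) ^ Δ * d⁻¹ * μ)
  rw [hκ]
  nlinarith

end Threshold

/-! ### Transfer to degrees in graphs -/

section Graph

variable {V C : Type*} [Fintype V] [DecidableEq V] [Fintype C] [DecidableEq C]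
  {G : SimpleGraph V} [DecidableRel G.Adj]

/-- The edges from `v` to `A`. -/
def edgesInto (G : SimpleGraph V) [DecidableRel G.Adj] (v : V) (A : Finset V) :
    Finset G.edgeSet :=
  Finset.univ.filter fun e => ∃ u ∈ A, (e : Sym2 V) = s(v, u)

theorem card_edgesInto_filter {v : V} {A : Finset V} (hA : A ⊆ G.neighborFinset v)
    (p : G.edgeSet → Prop) [DecidablePred p] :
    ((edgesInto G v A).filter p).card =
      {u : V | u ∈ A ∧ ∃ h : G.Adj v u, p ⟨s(v, u), h⟩}.ncard := by
  have hadj : ∀ u ∈ A, G.Adj v u := fun u hu => (G.mem_neighborFinset v u).1 (hA hu)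
  rw [← Set.ncard_coe_finset]
  symm
  refine Set.ncard_congr (fun u hu => ⟨s(v, u), hadj u hu.1⟩) ?_ ?_ ?_
  · rintro u ⟨hu, h, hp⟩
    simp only [edgesInto, Finset.coe_filter, Finset.mem_filter, Finset.mem_univ, true_and,
      Set.mem_ofPred_eq]
    exact ⟨⟨u, hu, rfl⟩, hp⟩
  · intro u u' _ _ h
    exact Sym2.congr_right.1 (Subtype.ext_iff.1 h)
  · rintro ⟨e, he⟩ h
    simp only [edgesInto, Finset.coe_filter, Finset.mem_filter, Finset.mem_univ, true_and,
      Set.mem_ofPred_eq] at h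
    obtain ⟨⟨u, hu, rfl⟩, hp⟩ := h
    exact ⟨u, ⟨hu, he, hp⟩, rfl⟩

theorem card_edgesInto {v : V} {A : Finset V} (hA : A ⊆ G.neighborFinset v) :
    (edgesInto G v A).card = A.card := by
  have h := card_edgesInto_filter hA (fun _ => True)
  rw [Finset.filter_true] at h
  rw [h, ← Set.ncard_coe_finset A]
  congr 1
  ext u
  exact ⟨fun hu => hu.1, fun hu => ⟨hu, (G.mem_neighborFinset v u).1 (hA hu), trivial⟩⟩

theorem mem_edgesInto_neighborFinset {v : V} {e : G.edgeSet} :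
    e ∈ edgesInto G v (G.neighborFinset v) ↔ v ∈ (e : Sym2 V) := by
  obtain ⟨e, he⟩ := e
  simp only [edgesInto, Finset.mem_filter, Finset.mem_univ, true_and]
  constructor
  · rintro ⟨u, -, rfl⟩
    exact Sym2.mem_mk_left _ _
  · intro h
    obtain ⟨u, rfl⟩ := Sym2.mem_iff_exists.1 h
    exact ⟨u, (G.mem_neighborFinset v u).2 he, rfl⟩

/-- The parts at a vertex are disjoint, so an edge is counted at most once from each of its two
ends. -/
theorem sum_card_edgesInto_filter_le (parts : V → Finset (Finset V))
    (hdisj : ∀ v, (parts v : Set (Finset V)).PairwiseDisjoint id) (p : G.edgeSet → Prop)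
    [DecidablePred p] :
    ∑ j : Σ v, parts v, ((edgesInto G j.1 j.2).filter p).card ≤
      2 * (Finset.univ.filter p).card := by
  rw [Fintype.sum_sigma]
  calc ∑ v, ∑ A : parts v, ((edgesInto G v A).filter p).card
      ≤ ∑ v, ((Finset.univ.filter p).filter fun e : G.edgeSet => v ∈ (e : Sym2 V)).card := by
        refine Finset.sum_le_sum fun v _ => ?_
        rw [← Finset.card_biUnion]
        · refine Finset.card_le_card fun e he => ?_
          obtain ⟨A, -, hA⟩ := Finset.mem_biUnion.1 he
          obtain ⟨h1, h2⟩ := Finset.mem_filter.1 hA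
          obtain ⟨u, -, hu⟩ := (Finset.mem_filter.1 h1).2
          simp only [Finset.mem_filter, Finset.mem_univ, true_and]
          exact ⟨h2, hu ▸ Sym2.mem_mk_left _ _⟩
        · rintro A - B - hAB
          refine Finset.disjoint_left.2 fun e hA hB => ?_
          obtain ⟨u, hu, hu'⟩ := (Finset.mem_filter.1 (Finset.mem_filter.1 hA).1).2
          obtain ⟨w, hw, hw'⟩ := (Finset.mem_filter.1 (Finset.mem_filter.1 hB).1).2
          have huw : u = w := Sym2.congr_right.1 (hu'.symm.trans hw')
          subst huw
          exact Finset.disjoint_left.1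
            (hdisj v A.2 B.2 fun h => hAB (Subtype.ext h)) hu hw
    _ = ∑ e ∈ Finset.univ.filter p, (Finset.univ.filter fun v => v ∈ (e : Sym2 V)).card := by
        simp_rw [Finset.card_filter]
        exact Finset.sum_comm
    _ ≤ ∑ e ∈ Finset.univ.filter p, 2 := by
        refine Finset.sum_le_sum fun e _ => ?_
        obtain ⟨e, he⟩ := e
        induction e with | _ a b => ?_
        refine le_trans (Finset.card_le_card (t := {a, b}) ?_) Finset.card_le_two
        intro v hv
        simpa using hv
    _ = _ := by rw [Finset.sum_const, smul_eq_mul, mul_comm]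

/-- Common source of both assertions. The lemma takes the whole neighbourhood as the only part, `r =
1`, and the profiles of a given type as `T`; the corollary takes the given parts and a constant
profile. -/
theorem le_splitMeasure_profile_degrees {n t Δ r : ℕ} {μ d κ : ℝ} (hn : 1 ≤ n) (ht : 1 ≤ t)
    (hΔ : 1 ≤ Δ) (hr : 1 ≤ r) (hμ : μ ∈ Set.Ioc (0 : ℝ) 1) (hd : d ∈ Set.Ioc (0 : ℝ) 1)
    (hκ : κ = 4 * √((t : ℝ) ^ Δ * d⁻¹ * μ)) (hκΔ : (Δ + 1) * κ ≤ 1 / 6)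
    (c : G.edgeSet → Finset C) (hV : Fintype.card V = n) (hc : ∀ e, (c e).card = Δ)
    (hbdd : IsBounded c (μ * n)) (parts : V → Finset (Finset V))
    (hsub : ∀ v, ∀ A ∈ parts v, A ⊆ G.neighborFinset v)
    (hdisj : ∀ v, (parts v : Set (Finset V)).PairwiseDisjoint id) :
    κ / 3 * ((1 + κ) ^ Fintype.card C)⁻¹ ≤ (splitMeasure C t).real
      {ω | ∀ v, ∀ A ∈ parts v, ∀ T : Finset (Fin Δ → Fin t),
        |(((edgesInto G v A).filter fun e => profile c hc ω e ∈ T).card : ℝ) -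
          T.card * ((t : ℝ) ^ Δ)⁻¹ * A.card| ≤ (2 * (t : ℝ)) ^ Δ * κ * r * n} := by
  classical
  have hκ0 : 0 ≤ κ := by rw [hκ]; positivity
  have hκ1 : κ ≤ 1 := by
    have : 0 ≤ (Δ : ℝ) * κ := by positivity
    linarith
  have ht0 : (0 : ℝ) < t := by exact_mod_cast ht
  have hb : ∀ α, ((Finset.univ.filter fun e => α ∈ c e).card : ℝ) ≤ μ * n := by
    intro α
    refine le_trans (le_of_eq ?_) (hbdd α)
    rw [← Set.ncard_coe_finset]
    simp
  have hcount := pow_card_le_mul_card_profile c hc hn ht hΔ hr hμ hd hκ hκΔ hb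
    (J := Σ v, parts v) (fun j => edgesInto G j.1 j.2)
    (fun j => by
      rw [card_edgesInto (hsub j.1 j.2 j.2.2), ← hV]
      exact Finset.card_le_univ _)
    (fun α => by
      have h := sum_card_edgesInto_filter_le (G := G) parts hdisj (fun e => α ∈ c e)
      have h' : ∑ j : Σ v, parts v,
          (((edgesInto G j.1 j.2).filter fun e => α ∈ c e).card : ℝ) ≤
          2 * ((Finset.univ.filter fun e => α ∈ c e).card : ℝ) := by exact_mod_cast h
      linarith [hb α])
  have hpow : (0 : ℝ) < (1 + κ) ^ Fintype.card C := by positivity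
  have h1 : ((1 + κ) ^ Fintype.card C)⁻¹ ≤ (splitMeasure C t).real
      {ω | ∀ (j : Σ v, parts v) (τ : Fin Δ → Fin t),
        (((edgesInto G j.1 j.2).filter fun e => profile c hc ω e = τ).card : ℝ) ≤
          (edgesInto G j.1 (j.2 : Finset V)).card / (t : ℝ) ^ Δ + 2 ^ Δ * κ * r * n} := by
    rw [splitMeasure_real_filter, le_div_iff₀ (by positivity), inv_mul_le_iff₀ hpow]
    exact hcount
  -- The counting gives the probability bound `(1 + κ) ^ (-|C|)`; the factor `κ / 3 ≤ 1` only
  -- weakens it.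
  have h2 : κ / 3 * ((1 + κ) ^ Fintype.card C)⁻¹ ≤ ((1 + κ) ^ Fintype.card C)⁻¹ :=
    mul_le_of_le_one_left (by positivity) (by linarith)
  refine (h2.trans h1).trans ?_
  refine measureReal_mono ?_ (splitMeasure_ne_top ht _)
  intro ω hω v A hA T
  have h3 := abs_card_profile_mem_sub_le c hc ht ω (edgesInto G v A)
    (D := 2 ^ Δ * κ * r * n) (fun τ => hω ⟨v, A, hA⟩ τ) (by positivity) T
  rw [card_edgesInto (hsub v A hA)] at h3
  refine h3.trans (le_of_eq ?_)
  rw [mul_pow]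
  ring

theorem typeDegree_eq_card {t Δ : ℕ} (c : G.edgeSet → Finset C) (hc : ∀ e, (c e).card = Δ)
    (ω : C → Fin t) (s : Fin t → ℕ) (v : V) :
    typeDegree c ω s v = ((edgesInto G v (G.neighborFinset v)).filter fun e =>
      profile c hc ω e ∈ Finset.univ.filter fun τ : Fin Δ → Fin t =>
        ∀ j, (Finset.univ.filter fun i => τ i = j).card = s j).card := by
  rw [typeDegree, ← Set.ncard_coe_finset]
  congr 1
  ext e
  simp only [Finset.coe_filter, Set.mem_ofPred_eq, mem_edgesInto_neighborFinset,
    Finset.mem_filter, Finset.mem_univ, true_and]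
  refine and_congr_right fun _ => forall_congr' fun j => ?_
  rw [card_filter_profile c hc ω e (fun i => i = j)]
  have : c e ∩ colourClass ω j = (c e).filter fun α => ω α = j := by
    ext α; simp [colourClass]
  rw [this]

theorem degreeInto_eq_card {t Δ : ℕ} (c : G.edgeSet → Finset C) (hc : ∀ e, (c e).card = Δ)
    (ω : C → Fin t) (l : Fin t) {v : V} {A : Finset V} (hA : A ⊆ G.neighborFinset v) :
    degreeInto (colourSubgraph c (colourClass ω l)) v A =
      ((edgesInto G v A).filter fun e =>
        profile c hc ω e ∈ ({fun _ => l} : Finset (Fin Δ → Fin t))).card := by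
  rw [card_edgesInto_filter hA, degreeInto]
  congr 1
  ext u
  simp only [Set.mem_ofPred_eq, colourSubgraph, SimpleGraph.fromEdgeSet_adj,
    Finset.mem_singleton, profile_eq_iff]
  refine and_congr_right fun _ => ?_
  have hsub : ∀ e, c e ⊆ colourClass ω l ↔ ∀ α, α ∈ c e → ω α = l := fun e => by
    simp [Finset.subset_iff, colourClass]
  constructor
  · rintro ⟨⟨h, h'⟩, -⟩
    exact ⟨h, (hsub _).1 h'⟩
  · rintro ⟨h, h'⟩
    exact ⟨⟨h, (hsub _).2 h'⟩, h.ne⟩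

end Graph

end ColourSplit

/-! ### The lemma and the corollary -/

theorem lemma4p7 :
    -- the lemma: degrees of every colour type
    (∃ f g : ℝ → ℝ, ColourSplit.IsThreshold f ∧ ColourSplit.IsThreshold g ∧
      ∀ (n t Δ : ℕ) (μ d κ : ℝ), 1 ≤ n → 1 ≤ t → 1 ≤ Δ →
        μ ∈ Set.Ioc (0 : ℝ) 1 → d ∈ Set.Ioc (0 : ℝ) 1 →
        1 / (n : ℝ) ≤ f μ →
        μ ≤ g (1 / (t : ℝ)) → μ ≤ g d → μ ≤ g (1 / (Δ : ℝ)) →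
        κ = 4 * √((t : ℝ) ^ Δ * d⁻¹ * μ) →
      ∀ (V : Type*) [Fintype V] [DecidableEq V] (C : Type*) [Fintype C] [DecidableEq C]
        (G : SimpleGraph V) [DecidableRel G.Adj] (c : G.edgeSet → Finset C),
        Fintype.card V = n →
        d * (n : ℝ) ≤ (G.minDegree : ℝ) →
        (∀ e, (c e).card = Δ) →
        ColourSplit.IsBounded c (μ * n) →
        κ / 3 * ((1 + κ) ^ Fintype.card C)⁻¹ ≤
          (ColourSplit.splitMeasure C t).real
            {ω | ∀ (v : V) (s : Fin t → ℕ), ∑ j, s j = Δ →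
              |(ColourSplit.typeDegree c ω s v : ℝ) -
                  (Nat.multinomial Finset.univ s : ℝ) * ((t : ℝ) ^ Δ)⁻¹ * (G.degree v : ℝ)| ≤
                (2 * (t : ℝ)) ^ Δ * κ * n}) ∧
    -- the corollary: degrees into the parts of given partitions of the neighbourhoods
    (∃ f g : ℝ → ℝ, ColourSplit.IsThreshold f ∧ ColourSplit.IsThreshold g ∧
      ∀ (n t Δ r : ℕ) (μ d κ : ℝ), 1 ≤ n → 1 ≤ t → 1 ≤ Δ → 1 ≤ r →
        μ ∈ Set.Ioc (0 : ℝ) 1 → d ∈ Set.Ioc (0 : ℝ) 1 →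
        1 / (n : ℝ) ≤ f μ →
        μ ≤ g (1 / (t : ℝ)) → μ ≤ g d → μ ≤ g (1 / (Δ : ℝ)) → μ ≤ g (1 / (r : ℝ)) →
        κ = 4 * √((t : ℝ) ^ Δ * d⁻¹ * μ) →
      ∀ (V : Type*) [Fintype V] [DecidableEq V] (C : Type*) [Fintype C] [DecidableEq C]
        (G : SimpleGraph V) [DecidableRel G.Adj] (c : G.edgeSet → Finset C)
        (S : ∀ v : V, Finpartition (G.neighborFinset v)),
        Fintype.card V = n →
        (∀ e, (c e).card = Δ) →
        ColourSplit.IsBounded c (μ * n) →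
        (∀ v, (S v).parts.card ≤ r) →
        (∀ v, ∀ A ∈ (S v).parts, d * (r : ℝ) * n ≤ (A.card : ℝ)) →
        κ / 3 * ((1 + κ) ^ Fintype.card C)⁻¹ ≤
          (ColourSplit.splitMeasure C t).real
            {ω | ∀ (v : V), ∀ A ∈ (S v).parts, ∀ ℓ : Fin t,
              |(ColourSplit.degreeInto
                    (ColourSplit.colourSubgraph c (ColourSplit.colourClass ω ℓ)) v A : ℝ) -
                  ((t : ℝ) ^ Δ)⁻¹ * (A.card : ℝ)| ≤
                (2 * (t : ℝ)) ^ Δ * κ * r * n}) := by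
  refine ⟨⟨id, ColourSplit.smallness, ColourSplit.isThreshold_id,
    ColourSplit.isThreshold_smallness, ?_⟩, ⟨id, ColourSplit.smallness,
    ColourSplit.isThreshold_id, ColourSplit.isThreshold_smallness, ?_⟩⟩
  · intro n t Δ μ d κ hn ht hΔ hμ hd _ h1 h2 h3 hκ V _ _ C _ _ G _ c hV _ hc hbdd
    have key := ColourSplit.le_splitMeasure_profile_degrees hn ht hΔ le_rfl hμ hd hκ
      (ColourSplit.mul_le_of_le_smallness ht hΔ hμ hd h1 h2 h3 hκ) c hV hc hbdd
      (fun v => {G.neighborFinset v})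
      (fun v A hA => (Finset.mem_singleton.1 hA).subset) (fun v => by simp)
    refine key.trans (measureReal_mono ?_ (ColourSplit.splitMeasure_ne_top ht _))
    intro ω hω v s hs
    have h := hω v _ (Finset.mem_singleton_self _) (Finset.univ.filter fun τ : Fin Δ → Fin t =>
      ∀ j, (Finset.univ.filter fun i => τ i = j).card = s j)
    rw [← ColourSplit.typeDegree_eq_card,
      ColourSplit.card_filter_fibre_card_eq_multinomial (ι := Fin Δ) s (by simpa using hs),
      SimpleGraph.card_neighborFinset_eq_degree, Nat.cast_one, mul_one] at h
    exact h
  · intro n t Δ r μ d κ hn ht hΔ hr hμ hd _ h1 h2 h3 _ hκ V _ _ C _ _ G _ c S hV hc hbdd _ _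
    have key := ColourSplit.le_splitMeasure_profile_degrees hn ht hΔ hr hμ hd hκ
      (ColourSplit.mul_le_of_le_smallness ht hΔ hμ hd h1 h2 h3 hκ) c hV hc hbdd
      (fun v => (S v).parts) (fun v A hA => (S v).le hA) (fun v => (S v).disjoint)
    refine key.trans (measureReal_mono ?_ (ColourSplit.splitMeasure_ne_top ht _))
    intro ω hω v A hA l
    have h := hω v A hA {fun _ => l}
    rw [← ColourSplit.degreeInto_eq_card c hc ω l ((S v).le hA), Finset.card_singleton,
      Nat.cast_one, one_mul] at h
    exact h
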